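/- For $u=(a,b,c,x,y,z)\in\mathbb R^6$ put $d_3(x,y,z)=(-x+y+z)(x-y+z)(x+y-z)$, $p_4(u)=abcxyz$, $n_4(u)=p_4(u)-d_3(xc,ay,bz)$, $v_4(u)=(b+z-c-x)(c+x-a-y)(a+y-b-z)$, $$\begin{aligned}z_4(u)={}&a^2y^2(b^2+c^2+x^2+z^2)+b^2z^2(a^2+c^2+x^2+y^2)+c^2x^2(a^2+b^2+y^2+z^2)\\&-(a^4y^2+a^2y^4+b^4z^2+b^2z^4+c^4x^2+c^2x^4)\\&-(a^2b^2x^2+a^2c^2z^2+b^2c^2y^2+x^2y^2z^2),\end{aligned}$$ $$d_4(u)=60p_4(u)+4n_4(u)+2z_4(u)+12\,\mathrm{av}\big[a\big((b+c)^2-y^2\big)d_3(x,y,z)\big],\qquad m_4=d_4-(64p_4+4z_4+v_4^2).$$ For points $A,B,C,D\in\mathbb R^3$ let $U(A,B,C,D)=(a,b,c,x,y,z)$ with $a=|AD|$, $b=|BD|$, $c=|CD|$, $x=|AB|$, $y=|BC|$, $z=|AC|$; a vector in the range of $U$ is called geometric. Each of the 24 permutations of the four points induces a permutation of the coordinates $(a,b,c,x,y,z)$.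 A polynomial is called symmetric if it is invariant under these 24 permutations, and $\mathrm{av}[f]$ is the average of $f$ over them. Identify $\mathbb R^3=\mathbb R\times\mathbb C$ and let $h:\mathbb C^2\to\mathbb R\times\mathbb C$, $h(z,w)=((|z|^2-|w|^2)/2,\,z\bar w)$, be the Hopf map. For distinct points $P_1,\dots,P_n\in\mathbb R^3$ choose $(z_{jk},w_{jk})\in h^{-1}(\overrightarrow{P_jP_k})$ for all $j\ne k$ so that $(z_{kj},w_{kj})=(-\overline{w_{jk}},\overline{z_{jk}})$ for $j<k$. The Atiyah determinant $\mathrm{At}(P_1,\dots,P_n)$ is the determinant of the $n\times n$ matrix whose $j$-th column is the coefficient vector (constant term first) of the polynomial $\prod_{k\ne j}(z_{jk}+w_{jk}T)$; it does not depend on the choices. If the points are not distinct, put $\mathrm{At}=0$. Then: 1. $m_4$ is a symmetric homogeneous polynomial of degree $6$, and $m_4(u)\ge 0$ for every geometric $u$. 2. $d_4(u)\ge 64\,abcxyz$ for every geometric $u=(a,b,c,x,y,z)$. 3. For all $A,B,C,D\in\mathbb R^3$, $|\mathrm{At}(A,B,C,D)|\ge\operatorname{Re}\mathrm{At}(A,B,C,D)=d_4(U(A,B,C,D))$.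 4. For all $A,B,C,D\in\mathbb R^3$, $|\mathrm{At}(A,B,C,D)|\ge 64\,abcxyz$, where $(a,b,c,x,y,z)=U(A,B,C,D)$ (Conjecture II of Atiyah and Sutcliffe for $n=4$). -/

import Mathlib

/-- The triangle polynomial `d₃(x,y,z) = (-x+y+z)(x-y+z)(x+y-z)`, in an arbitrary commutative ring. -/
def d3 {R : Type*} [CommRing R] (x y z : R) : R :=
  (-x + y + z) * (x - y + z) * (x + y - z)

/-! ### The Atiyah determinant of `n` points of `ℝ³` -/

noncomputable section

/-- Euclidean three-space. -/
abbrev E3 : Type := EuclideanSpace ℝ (Fin 3)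

/-- The identification of `ℝ³` with `ℝ × ℂ`. -/
def toRC (v : E3) : ℝ × ℂ := (v 0, ⟨v 1, v 2⟩)

/-- The Hopf map `h(z,w) = ((|z|² - |w|²)/2, z w̄)`. -/
def hopf (q : ℂ × ℂ) : ℝ × ℂ :=
  ((‖q.1‖ ^ 2 - ‖q.2‖ ^ 2) / 2, q.1 * starRingEnd ℂ q.2)

/-- The map `(z,w) ↦ (-w̄, z̄)`, which covers `v ↦ -v` under the Hopf map. -/
def antipode (q : ℂ × ℂ) : ℂ × ℂ := (-starRingEnd ℂ q.2, starRingEnd ℂ q.1)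

/-- `L i j` is a choice of Hopf lifts of the vectors from `P i` to `P j` (for `i ≠ j`), normalized so
that for `i < j` the lift of the reversed vector is the antipode of the chosen lift. -/
structure IsNormalizedLift {n : ℕ} (P : Fin n → E3) (L : Fin n → Fin n → ℂ × ℂ) : Prop where
  hopf_eq : ∀ i j, i ≠ j → hopf (L i j) = toRC (P j - P i)
  antipode_eq : ∀ i j, i < j → L j i = antipode (L i j)

open Polynomial in
/-- The matrix whose `j`-th column is the symmetric product of the lifts `L j k` with `k ≠ j`: the
symmetric product of vectors `(z_k, w_k)` of `ℂ²` is the coefficient vector of `∏ (z_k + w_k X)`. -/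
def liftMatrix {n : ℕ} (L : Fin n → Fin n → ℂ × ℂ) : Matrix (Fin n) (Fin n) ℂ :=
  Matrix.of fun i j =>
    (∏ k ∈ Finset.univ.erase j, (C (L j k).1 + C (L j k).2 * X)).coeff (i : ℕ)

/-- An explicit Hopf lift of a vector of `ℝ³`. -/
def hopfLift (v : E3) : ℂ × ℂ :=
  if ‖v‖ + v 0 = 0 then (0, (√(2 * ‖v‖) : ℝ))
  else ((√(‖v‖ + v 0) : ℝ), (⟨v 1, -v 2⟩ : ℂ) / (√(‖v‖ + v 0) : ℝ))

/-- An explicit normalized system of Hopf lifts. -/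
def normalizedLift {n : ℕ} (P : Fin n → E3) (i j : Fin n) : ℂ × ℂ :=
  if i < j then hopfLift (P j - P i) else antipode (hopfLift (P i - P j))

open Classical in
/-- The Atiyah determinant, with the convention that it is `0` when the points are not distinct.
By `atiyahDet_eq` below, every normalized system of lifts gives the same value. -/
def atiyahDet {n : ℕ} (P : Fin n → E3) : ℂ :=
  if Function.Injective P then (liftMatrix (normalizedLift P)).det else 0

theorem norm_sq_E3 (v : E3) : ‖v‖ ^ 2 = v 0 ^ 2 + v 1 ^ 2 + v 2 ^ 2 := by
  rw [EuclideanSpace.norm_sq_eq, Fin.sum_univ_three]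
  simp

theorem hopf_hopfLift (v : E3) : hopf (hopfLift v) = toRC v := by
  have hn := norm_sq_E3 v
  have h0 : 0 ≤ ‖v‖ := norm_nonneg v
  have hle : -‖v‖ ≤ v 0 := by
    have : |v 0| ≤ ‖v‖ := by
      apply abs_le_of_sq_le_sq _ h0
      nlinarith [sq_nonneg (v 1), sq_nonneg (v 2)]
    exact (abs_le.mp this).1
  unfold hopf hopfLift toRC
  split_ifs with h
  · have e : v 0 = -‖v‖ := by linarith
    have h12 : v 1 ^ 2 + v 2 ^ 2 = 0 := by rw [e] at hn; nlinarith
    have h1 : v 1 = 0 := by nlinarith [sq_nonneg (v 1), sq_nonneg (v 2)]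
    have h2 : v 2 = 0 := by nlinarith [sq_nonneg (v 1), sq_nonneg (v 2)]
    refine Prod.ext ?_ ?_
    · simp [Real.sq_sqrt h0, e, mul_pow]
      ring
    · apply Complex.ext <;> simp [h1, h2]
  · have hpos : 0 < ‖v‖ + v 0 := lt_of_le_of_ne (by linarith) (Ne.symm h)
    set s := √(‖v‖ + v 0) with hs
    have hs0 : 0 < s := Real.sqrt_pos.mpr hpos
    have hs2 : s ^ 2 = ‖v‖ + v 0 := Real.sq_sqrt hpos.le
    have hsC : (s : ℂ) ≠ 0 := by exact_mod_cast hs0.ne'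
    have hnz : ‖(⟨v 1, -v 2⟩ : ℂ)‖ ^ 2 = v 1 ^ 2 + v 2 ^ 2 := by
      rw [← Complex.normSq_eq_norm_sq, Complex.normSq_mk]; ring
    refine Prod.ext ?_ ?_
    · simp only [norm_div, Complex.norm_real, Real.norm_eq_abs, sq_abs, div_pow, hnz]
      rw [hs2]
      field_simp
      nlinarith
    · simp only [map_div₀, Complex.conj_ofReal]
      rw [mul_div_cancel₀ _ hsC]
      apply Complex.ext <;> simp

theorem hopf_antipode (q : ℂ × ℂ) : hopf (antipode q) = -hopf q := by
  unfold hopf antipode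
  refine Prod.ext ?_ ?_
  · simp; ring
  · simp; ring

theorem toRC_neg (v : E3) : toRC (-v) = -toRC v := by
  refine Prod.ext ?_ ?_
  · simp [toRC]
  · apply Complex.ext <;> simp [toRC]

theorem isNormalizedLift_normalizedLift {n : ℕ} (P : Fin n → E3) :
    IsNormalizedLift P (normalizedLift P) where
  hopf_eq i j hij := by
    unfold normalizedLift
    split_ifs with h
    · exact hopf_hopfLift _
    · rw [hopf_antipode, hopf_hopfLift, ← toRC_neg, neg_sub]
  antipode_eq i j hij := by
    unfold normalizedLift
    rw [if_neg (not_lt.mpr hij.le), if_pos hij]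

theorem exists_phase {q q' : ℂ × ℂ} (h : hopf q' = hopf q) :
    ∃ c : ℂ, c * starRingEnd ℂ c = 1 ∧ q'.1 = c * q.1 ∧ q'.2 = c * q.2 := by
  obtain ⟨z, w⟩ := q
  obtain ⟨z', w'⟩ := q'
  simp only [hopf, Prod.mk.injEq] at h
  obtain ⟨h1, h2⟩ := h
  have h3 : ‖z'‖ * ‖w'‖ = ‖z‖ * ‖w‖ := by simpa using congrArg norm h2
  have hz0 := norm_nonneg z
  have hz0' := norm_nonneg z'
  have hw0 := norm_nonneg w
  have hw0' := norm_nonneg w'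
  have hsum : ‖z'‖ ^ 2 + ‖w'‖ ^ 2 = ‖z‖ ^ 2 + ‖w‖ ^ 2 := by
    have e1 : (‖z'‖ ^ 2 + ‖w'‖ ^ 2) ^ 2 = (‖z‖ ^ 2 + ‖w‖ ^ 2) ^ 2 := by
      have e2 : ‖z'‖ ^ 2 - ‖w'‖ ^ 2 = ‖z‖ ^ 2 - ‖w‖ ^ 2 := by linarith
      calc _ = (‖z'‖ ^ 2 - ‖w'‖ ^ 2) ^ 2 + 4 * (‖z'‖ * ‖w'‖) ^ 2 := by ring
        _ = (‖z‖ ^ 2 - ‖w‖ ^ 2) ^ 2 + 4 * (‖z‖ * ‖w‖) ^ 2 := by rw [e2, h3]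
        _ = _ := by ring
    exact (pow_left_inj₀ (by positivity) (by positivity) two_ne_zero).mp e1
  have hz : ‖z'‖ = ‖z‖ :=
    (pow_left_inj₀ hz0' hz0 two_ne_zero).mp (by linarith)
  have hw : ‖w'‖ = ‖w‖ :=
    (pow_left_inj₀ hw0' hw0 two_ne_zero).mp (by linarith)
  have unit : ∀ {s t : ℂ}, s ≠ 0 → ‖t‖ = ‖s‖ → t / s * starRingEnd ℂ (t / s) = 1 := by
    intro s t hs hst
    rw [Complex.mul_conj, Complex.normSq_eq_norm_sq, norm_div, hst,
      div_self (norm_ne_zero_iff.mpr hs)]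
    simp
  by_cases hzz : z = 0
  · have hz' : z' = 0 := by simpa [hzz] using hz
    by_cases hww : w = 0
    · have hw' : w' = 0 := by simpa [hww] using hw
      exact ⟨1, by simp [hzz, hww, hz', hw']⟩
    · exact ⟨w' / w, unit hww hw, by simp [hzz, hz'], by simp [hww]⟩
  · have hu := unit hzz hz
    refine ⟨z' / z, hu, by simp [hzz], ?_⟩
    have h4 : starRingEnd ℂ w = z' / z * starRingEnd ℂ w' := by
      field_simp
      linear_combination -h2
    have h5 : w = starRingEnd ℂ (z' / z) * w' := by
      simpa using congrArg (starRingEnd ℂ) h4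
    change w' = z' / z * w
    rw [h5, ← mul_assoc, hu, one_mul]

/-- The determinant does not depend on the choice of the normalized lifts. -/
theorem det_liftMatrix_eq {n : ℕ} {P : Fin n → E3} {L L' : Fin n → Fin n → ℂ × ℂ}
    (hL : IsNormalizedLift P L) (hL' : IsNormalizedLift P L') :
    (liftMatrix L').det = (liftMatrix L).det := by
  have hex : ∀ i j, i ≠ j → ∃ c : ℂ, c * starRingEnd ℂ c = 1 ∧
      (L' i j).1 = c * (L i j).1 ∧ (L' i j).2 = c * (L i j).2 := fun i j hij =>
    exists_phase ((hL'.hopf_eq i j hij).trans (hL.hopf_eq i j hij).symm)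
  choose! c hc using hex
  -- phases, conjugate under reversal
  let l : Fin n → Fin n → ℂ := fun i j =>
    if i < j then c i j else if j < i then starRingEnd ℂ (c j i) else 1
  have hl1 : ∀ i j, l i j * l j i = 1 := by
    intro i j
    rcases lt_trichotomy i j with h | h | h
    · simp [l, h, not_lt.mpr h.le, (hc i j h.ne).1]
    · simp [l, h]
    · simp only [l, h, not_lt.mpr h.le, if_true, if_false]
      rw [mul_comm]; exact (hc j i h.ne).1
  have hl2 : ∀ i j, i ≠ j →
      (L' i j).1 = l i j * (L i j).1 ∧ (L' i j).2 = l i j * (L i j).2 := by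
    intro i j hij
    rcases lt_or_gt_of_ne hij with h | h
    · simpa [l, h] using (hc i j hij).2
    · rw [hL'.antipode_eq j i h, hL.antipode_eq j i h]
      simp [l, h, not_lt.mpr h.le, antipode, (hc j i h.ne).2.1, (hc j i h.ne).2.2]
  have hM : liftMatrix L' =
      Matrix.of fun i j => (∏ k ∈ Finset.univ.erase j, l j k) * liftMatrix L i j := by
    ext i j
    simp only [liftMatrix, Matrix.of_apply]
    rw [← Polynomial.coeff_C_mul, map_prod, ← Finset.prod_mul_distrib]
    congr 1
    refine Finset.prod_congr rfl fun k hk => ?_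
    have hjk : j ≠ k := (Finset.ne_of_mem_erase hk).symm
    rw [(hl2 j k hjk).1, (hl2 j k hjk).2, Polynomial.C_mul, Polynomial.C_mul]
    ring
  rw [hM, Matrix.det_mul_row]
  have hprod : ∏ j, ∏ k ∈ Finset.univ.erase j, l j k = 1 := by
    rw [Finset.prod_sigma']
    refine Finset.prod_involution (fun x _ => ⟨x.2, x.1⟩) ?_ ?_ ?_ ?_
    · intro x _; exact hl1 _ _
    · rintro ⟨i, j⟩ hx _ h
      simp only [Sigma.mk.injEq, heq_eq_eq] at h
      simp [h.1] at hx
    · rintro ⟨i, j⟩ hx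
      simp at hx ⊢
      exact fun h => hx h.symm
    · intro x _; rfl
  rw [hprod, one_mul]

theorem atiyahDet_eq {n : ℕ} {P : Fin n → E3} (hP : Function.Injective P)
    {L : Fin n → Fin n → ℂ × ℂ} (hL : IsNormalizedLift P L) :
    atiyahDet P = (liftMatrix L).det := by
  rw [atiyahDet, if_pos hP]
  exact det_liftMatrix_eq hL (isNormalizedLift_normalizedLift P)

/-! ### Distance vectors and symmetric polynomials -/

/-- The vector `(a,b,c,x,y,z)` of pairwise distances, where
`a = |AD|`, `b = |BD|`, `c = |CD|`, `x = |AB|`, `y = |BC|`, `z = |AC|`. -/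
def distVec (A B C D : E3) : Fin 6 → ℝ :=
  ![dist A D, dist B D, dist C D, dist A B, dist B C, dist A C]

/-- A vector is geometric if it is the distance vector of four points of `ℝ³`. -/
def IsGeometric (u : Fin 6 → ℝ) : Prop := ∃ A B C D : E3, distVec A B C D = u

/-- Real polynomials in the six variables `a, b, c, x, y, z`, indexed `0, …, 5` in this order. -/
abbrev Poly6 : Type := MvPolynomial (Fin 6) ℝ

/-- The 24 permutations of `(a,b,c,x,y,z)` that permutations of the four points induce: the `i`-th
one sends `u` to `u_i = fun k => u (edgePerm i k)`. -/
def edgePerm : Fin 24 → Fin 6 → Fin 6 :=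
  ![![0, 1, 2, 3, 4, 5], ![0, 3, 5, 1, 4, 2], ![1, 2, 0, 4, 5, 3], ![3, 1, 4, 0, 2, 5],
    ![2, 0, 1, 5, 3, 4], ![5, 4, 2, 3, 1, 0], ![4, 5, 2, 3, 0, 1], ![2, 1, 0, 4, 3, 5],
    ![3, 4, 1, 5, 2, 0], ![0, 2, 1, 5, 4, 3], ![5, 3, 0, 4, 1, 2], ![1, 0, 2, 3, 5, 4],
    ![5, 2, 4, 0, 1, 3], ![3, 5, 0, 4, 2, 1], ![3, 0, 5, 1, 2, 4], ![4, 3, 1, 5, 0, 2],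
    ![4, 1, 3, 2, 0, 5], ![4, 2, 5, 1, 0, 3], ![2, 4, 5, 1, 3, 0], ![5, 0, 3, 2, 1, 4],
    ![1, 3, 4, 0, 5, 2], ![2, 5, 4, 0, 3, 1], ![0, 5, 3, 2, 4, 1], ![1, 4, 3, 2, 5, 0]]

/-- A polynomial is symmetric if `f(u) = f(u_i)` for each of the 24 permutations. -/
def IsSymm6 (f : Poly6) : Prop := ∀ i, MvPolynomial.rename (edgePerm i) f = f

/-- The symmetric average `av[f](u) = (1/24) ∑ f(u_i)`. -/
def av (f : Poly6) : Poly6 :=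
  MvPolynomial.C (1 / 24) * ∑ i, MvPolynomial.rename (edgePerm i) f

/-- The variable `a`. -/
abbrev va : Poly6 := MvPolynomial.X 0
/-- The variable `b`. -/
abbrev vb : Poly6 := MvPolynomial.X 1
/-- The variable `c`. -/
abbrev vc : Poly6 := MvPolynomial.X 2
/-- The variable `x`. -/
abbrev vx : Poly6 := MvPolynomial.X 3
/-- The variable `y`. -/
abbrev vy : Poly6 := MvPolynomial.X 4
/-- The variable `z`. -/
abbrev vz : Poly6 := MvPolynomial.X 5

/-- `p₄ = abcxyz`. -/
def p4 : Poly6 := va * vb * vc * vx * vy * vz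

/-- `n₄ = p₄ - d₃(xc, ay, bz)`. -/
def n4 : Poly6 := p4 - d3 (vx * vc) (va * vy) (vb * vz)

/-- The polynomial that equals `144 V²` on geometric vectors, `V` the volume of the tetrahedron. -/
def z4 : Poly6 :=
  va ^ 2 * vy ^ 2 * (vb ^ 2 + vc ^ 2 + vx ^ 2 + vz ^ 2)
    + vb ^ 2 * vz ^ 2 * (va ^ 2 + vc ^ 2 + vx ^ 2 + vy ^ 2)
    + vc ^ 2 * vx ^ 2 * (va ^ 2 + vb ^ 2 + vy ^ 2 + vz ^ 2)
    - (va ^ 4 * vy ^ 2 + va ^ 2 * vy ^ 4 + vb ^ 4 * vz ^ 2 + vb ^ 2 * vz ^ 4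
        + vc ^ 4 * vx ^ 2 + vc ^ 2 * vx ^ 4)
    - (va ^ 2 * vb ^ 2 * vx ^ 2 + va ^ 2 * vc ^ 2 * vz ^ 2 + vb ^ 2 * vc ^ 2 * vy ^ 2
        + vx ^ 2 * vy ^ 2 * vz ^ 2)

/-- `v₄ = (b+z-c-x)(c+x-a-y)(a+y-b-z)`. -/
def v4 : Poly6 := (vb + vz - vc - vx) * (vc + vx - va - vy) * (va + vy - vb - vz)

/-- `d₄ = 60 p₄ + 4 n₄ + 2 z₄ + 12 av[a((b+c)² - y²) d₃(x,y,z)]`. -/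
def d4 : Poly6 :=
  60 * p4 + 4 * n4 + 2 * z4 + 12 * av (va * ((vb + vc) ^ 2 - vy ^ 2) * d3 vx vy vz)

/-- `m₄ = d₄ - (64 p₄ + 4 z₄ + v₄²)`. -/
def m4 : Poly6 := d4 - (64 * p4 + 4 * z4 + v4 ^ 2)

end

/-!
The inequality `d₄ ≥ 64 p₄` follows from `d₄ - 64 p₄ = m₄ + 4 z₄ + v₄²`. Here `z₄ = 144 V²` is four
times the square of the determinant of three edge vectors (`eval_z4_nonneg`). The polynomial `m₄` is
nonnegative wherever the twelve triangle inequalities on the four faces hold: it is the average over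
the 24 relabelings of the points of an explicit combination, with positive coefficients, of products
of six triangle excesses and of products of four excesses with a square (`m4Summand`,
`eval_m4_eq_average`). The average defining `d₄` is written out once (`eval_d4`), after which symmetry
of `m₄` is checked on three generators of the group of relabelings.

For the determinant, the antipodal lifts on an edge `ij` contribute one linear factor to column `i` and
one to column `j`, so the determinant is linear in the tensor product of the two factors, that is, in
the length and the vector of the edge. Its real part is a polynomial in the lengths and the inner
products of the edge vectors (`re_det_cubicMatrix`), and inner products of edge vectors are
combinations of squared distances (`hopfInner_eq`). Substituting gives `d₄`. Conjecture II for four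
points is then `|At| ≥ Re At = d₄ ≥ 64 abcxyz`.
-/

/-! ### Evaluation of the polynomials -/

/-- One summand of the positivity certificate for `m₄`: a combination, with positive coefficients, of
products of triangle excesses such as `a + b - x`, one of them times a square. -/
def m4Summand (a b c x y z : ℝ) : ℝ :=
  6 * ((-a + b + x) * (a - b + x) * (-b + c + y) * (b + c - y) * (-a + c + z) * (a + c - z))
    + 12 * ((-a + b + x) * (a - b + x) * (a + b - x) * (-b + c + y) * (b - c + y) * (x - y + z))
    + 6 * ((-a + b + x) ^ 2 * (a - b + x) * (a + b - x) * (-b + c + y) * (-a + c + z))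
    + 4 * ((-a + b + x) * (a - b + x) * (a + b - x) * (-b + c + y) * (-a + c + z) * (-x + y + z))
    + 6 * (((-a + b + x) - (b - c + y)) ^ 2
        * ((-a + b + x) * (a - b + x) * (a + c - z) * (x + y - z)))

/-- A sum over the 24 relabelings, written out. -/
theorem sum_edgePerm (F : ℝ → ℝ → ℝ → ℝ → ℝ → ℝ → ℝ) (a b c x y z : ℝ) :
    ∑ i, F (![a, b, c, x, y, z] (edgePerm i 0)) (![a, b, c, x, y, z] (edgePerm i 1))
      (![a, b, c, x, y, z] (edgePerm i 2)) (![a, b, c, x, y, z] (edgePerm i 3))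
      (![a, b, c, x, y, z] (edgePerm i 4)) (![a, b, c, x, y, z] (edgePerm i 5)) =
    F a b c x y z + F a x z b y c + F b c a y z x + F x b y a c z + F c a b z x y
      + F z y c x b a + F y z c x a b + F c b a y x z + F x y b z c a + F a c b z y x
      + F z x a y b c + F b a c x z y + F z c y a b x + F x z a y c b + F x a z b c y
      + F y x b z a c + F y b x c a z + F y c z b a x + F c y z b x a + F z a x c b y
      + F b x y a z c + F c z y a x b + F a z x c y b + F b y x c z a := by
  simp only [Fin.sum_univ_castSucc, Fin.sum_univ_zero, zero_add]
  rfl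

theorem eval_av (u : Fin 6 → ℝ) (f : Poly6) :
    MvPolynomial.eval u (av f) = 1 / 24 * ∑ i, MvPolynomial.eval (u ∘ edgePerm i) f := by
  simp [av, MvPolynomial.eval_rename]

/-- `d₄` written out; the average in its definition runs over twelve distinct terms, each twice. -/
theorem eval_d4 (a b c x y z : ℝ) :
    MvPolynomial.eval ![a, b, c, x, y, z] d4 =
      60 * (a * b * c * x * y * z)
      + 4 * (a * b * c * x * y * z - d3 (x * c) (a * y) (b * z))
      + 2 * MvPolynomial.eval ![a, b, c, x, y, z] z4
      + (a * ((b + c) ^ 2 - y ^ 2) * d3 x y z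
        + a * ((x + z) ^ 2 - y ^ 2) * d3 b c y
        + b * ((a + c) ^ 2 - z ^ 2) * d3 x y z
        + b * ((x + y) ^ 2 - z ^ 2) * d3 a c z
        + c * ((a + b) ^ 2 - x ^ 2) * d3 x y z
        + c * ((y + z) ^ 2 - x ^ 2) * d3 a b x
        + x * ((a + z) ^ 2 - c ^ 2) * d3 b c y
        + x * ((b + y) ^ 2 - c ^ 2) * d3 a c z
        + y * ((b + x) ^ 2 - a ^ 2) * d3 a c z
        + y * ((c + z) ^ 2 - a ^ 2) * d3 a b x
        + z * ((a + x) ^ 2 - b ^ 2) * d3 b c y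
        + z * ((c + y) ^ 2 - b ^ 2) * d3 a b x) := by
  have h := sum_edgePerm (fun a b c x y z => a * ((b + c) ^ 2 - y ^ 2) * d3 x y z) a b c x y z
  have h' := eval_av ![a, b, c, x, y, z] (va * ((vb + vc) ^ 2 - vy ^ 2) * d3 vx vy vz)
  have e : ∀ v : Fin 6 → ℝ, MvPolynomial.eval v (va * ((vb + vc) ^ 2 - vy ^ 2) * d3 vx vy vz) =
    v 0 * ((v 1 + v 2) ^ 2 - v 4 ^ 2) * d3 (v 3) (v 4) (v 5) := fun v => by simp [d3]
  simp only [e, Function.comp_apply] at h'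
  rw [h] at h'
  simp only [d4, map_add, map_mul, h', map_ofNat]
  have e1 : MvPolynomial.eval ![a, b, c, x, y, z] p4 = a * b * c * x * y * z := by simp [p4]
  have e2 : MvPolynomial.eval ![a, b, c, x, y, z] n4
    = a * b * c * x * y * z - d3 (x * c) (a * y) (b * z) := by simp [n4, p4, d3]
  rw [e1, e2]
  simp only [d3]
  ring

theorem eval_z4 (a b c x y z : ℝ) :
    MvPolynomial.eval ![a, b, c, x, y, z] z4 =
      a ^ 2 * y ^ 2 * (b ^ 2 + c ^ 2 + x ^ 2 + z ^ 2)
        + b ^ 2 * z ^ 2 * (a ^ 2 + c ^ 2 + x ^ 2 + y ^ 2)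
        + c ^ 2 * x ^ 2 * (a ^ 2 + b ^ 2 + y ^ 2 + z ^ 2)
        - (a ^ 4 * y ^ 2 + a ^ 2 * y ^ 4 + b ^ 4 * z ^ 2 + b ^ 2 * z ^ 4
            + c ^ 4 * x ^ 2 + c ^ 2 * x ^ 4)
        - (a ^ 2 * b ^ 2 * x ^ 2 + a ^ 2 * c ^ 2 * z ^ 2 + b ^ 2 * c ^ 2 * y ^ 2
            + x ^ 2 * y ^ 2 * z ^ 2) := by
  simp [z4]

theorem eval_m4 (a b c x y z : ℝ) :
    MvPolynomial.eval ![a, b, c, x, y, z] m4 =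
      MvPolynomial.eval ![a, b, c, x, y, z] d4 - (64 * (a * b * c * x * y * z)
        + 4 * MvPolynomial.eval ![a, b, c, x, y, z] z4
        + ((b + z - c - x) * (c + x - a - y) * (a + y - b - z)) ^ 2) := by
  simp [m4, p4, v4]

/-- The positivity certificate: `m₄` is the average of `m4Summand` over the 24 relabelings. -/
theorem eval_m4_eq_average (a b c x y z : ℝ) :
    MvPolynomial.eval ![a, b, c, x, y, z] m4 = 1 / 24 * ∑ i,
      m4Summand (![a, b, c, x, y, z] (edgePerm i 0)) (![a, b, c, x, y, z] (edgePerm i 1))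
        (![a, b, c, x, y, z] (edgePerm i 2)) (![a, b, c, x, y, z] (edgePerm i 3))
        (![a, b, c, x, y, z] (edgePerm i 4)) (![a, b, c, x, y, z] (edgePerm i 5)) := by
  rw [sum_edgePerm, eval_m4, eval_d4, eval_z4]
  simp only [m4Summand, d3]
  ring

/-! ### Positivity on geometric vectors -/

theorem m4Summand_nonneg {a b c x y z : ℝ}
    (h0 : 0 ≤ -a + b + x) (h1 : 0 ≤ a - b + x) (h2 : 0 ≤ a + b - x)
    (h3 : 0 ≤ -b + c + y) (h4 : 0 ≤ b - c + y) (h5 : 0 ≤ b + c - y)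
    (h6 : 0 ≤ -a + c + z) (h8 : 0 ≤ a + c - z)
    (h9 : 0 ≤ -x + y + z) (h10 : 0 ≤ x - y + z) (h11 : 0 ≤ x + y - z) :
    0 ≤ m4Summand a b c x y z := by
  unfold m4Summand
  positivity

/-- The twelve triangle inequalities on the four faces already force `m₄ ≥ 0`. -/
theorem eval_m4_nonneg (A B C D : E3) : 0 ≤ MvPolynomial.eval (distVec A B C D) m4 := by
  have t1 := dist_triangle A D B
  have t2 := dist_triangle A B D
  have t3 := dist_triangle B A D
  have t4 := dist_triangle B D C
  have t5 := dist_triangle B C D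
  have t6 := dist_triangle C B D
  have t7 := dist_triangle A D C
  have t8 := dist_triangle A C D
  have t9 := dist_triangle C A D
  have t10 := dist_triangle A B C
  have t11 := dist_triangle A C B
  have t12 := dist_triangle B A C
  rw [dist_comm D B] at t1
  rw [dist_comm B A] at t3
  rw [dist_comm D C] at t4
  rw [dist_comm C B] at t6
  rw [dist_comm D C] at t7
  rw [dist_comm C A] at t9
  rw [dist_comm C B] at t11
  rw [dist_comm B A] at t12
  unfold distVec
  rw [eval_m4_eq_average]
  refine mul_nonneg (by norm_num) ?_
  generalize dist A D = a at *
  generalize dist B D = b at *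
  generalize dist C D = c at *
  generalize dist A B = x at *
  generalize dist B C = y at *
  generalize dist A C = z at *
  rw [sum_edgePerm]
  repeat' with_reducible apply add_nonneg
  all_goals apply m4Summand_nonneg <;> linarith

theorem dist_sq_E3 (P Q : E3) :
    dist P Q ^ 2 = (P 0 - Q 0) ^ 2 + (P 1 - Q 1) ^ 2 + (P 2 - Q 2) ^ 2 := by
  rw [dist_eq_norm, norm_sq_E3]
  rfl

/-- `z₄` is four times the square of the determinant of the edge vectors at `D`. -/
theorem eval_z4_nonneg (A B C D : E3) : 0 ≤ MvPolynomial.eval (distVec A B C D) z4 := by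
  -- with `D` moved to the origin only nine coordinates are left to expand
  have sq : ∀ P Q : E3, dist P Q ^ 2 = ((P 0 - D 0) - (Q 0 - D 0)) ^ 2
      + ((P 1 - D 1) - (Q 1 - D 1)) ^ 2 + ((P 2 - D 2) - (Q 2 - D 2)) ^ 2 :=
    fun P Q => by rw [dist_sq_E3]; ring
  have quart : ∀ P Q : E3, dist P Q ^ 4 = (dist P Q ^ 2) ^ 2 := fun P Q => by ring
  unfold distVec
  rw [eval_z4, quart A D, quart B D, quart C D, quart A B, quart B C, quart A C,
    sq A B, sq B C, sq A C, dist_sq_E3 A D, dist_sq_E3 B D, dist_sq_E3 C D]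
  generalize A 0 - D 0 = a0, A 1 - D 1 = a1, A 2 - D 2 = a2
  generalize B 0 - D 0 = b0, B 1 - D 1 = b1, B 2 - D 2 = b2
  generalize C 0 - D 0 = c0, C 1 - D 1 = c1, C 2 - D 2 = c2
  have hdet : 0 ≤ 4 * (a0 * (b1 * c2 - b2 * c1) - a1 * (b0 * c2 - b2 * c0)
      + a2 * (b0 * c1 - b1 * c0)) ^ 2 := by
    positivity
  refine hdet.trans_eq ?_
  ring

/-- `d₄ - 64 p₄` is the sum of the nonnegative quantities `m₄`, `4 z₄` and `v₄²`. -/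
theorem le_eval_d4 (A B C D : E3) :
    64 * (dist A D * dist B D * dist C D * dist A B * dist B C * dist A C) ≤
      MvPolynomial.eval (distVec A B C D) d4 := by
  have h := eval_m4_nonneg A B C D
  have hz := eval_z4_nonneg A B C D
  unfold distVec at *
  rw [eval_m4] at h
  have hv := sq_nonneg ((dist B D + dist A C - dist C D - dist A B)
    * (dist C D + dist A B - dist A D - dist B C) * (dist A D + dist B C - dist B D - dist A C))
  linarith

/-! ### Symmetry and homogeneity -/

/-- The 24 relabelings are the products of powers of a 4-cycle, a 3-cycle and a transposition of the
points, so invariance has to be checked for these three only. -/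
theorem IsSymm6.of_generators {f : Poly6}
    (h4 : MvPolynomial.rename (edgePerm 13) f = f)
    (h3 : MvPolynomial.rename (edgePerm 2) f = f)
    (h2 : MvPolynomial.rename (edgePerm 11) f = f) : IsSymm6 f := by
  have hpow : ∀ {g : Fin 6 → Fin 6}, MvPolynomial.rename g f = f → ∀ n : ℕ,
      MvPolynomial.rename g^[n] f = f := by
    intro g hg n
    induction n with
    | zero => exact MvPolynomial.rename_id_apply f
    | succ n ih =>
      rw [Function.iterate_succ, ← MvPolynomial.rename_rename, hg, ih]
  have hgen : ∀ i, ∃ k : Fin 4, ∃ l : Fin 3, ∃ m : Fin 2, ∀ j,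
      edgePerm i j = (edgePerm 13)^[k] ((edgePerm 2)^[l] ((edgePerm 11)^[m] j)) := by
    decide
  intro i
  obtain ⟨k, l, m, h⟩ := hgen i
  have : edgePerm i = (edgePerm 13)^[k] ∘ (edgePerm 2)^[l] ∘ (edgePerm 11)^[m] := funext h
  rw [this, ← MvPolynomial.rename_rename, ← MvPolynomial.rename_rename, hpow h2, hpow h3, hpow h4]

theorem isSymm6_m4 : IsSymm6 m4 := by
  -- over the infinite field `ℝ` it is enough to compare values
  have hu : ∀ u : Fin 6 → ℝ, u = ![u 0, u 1, u 2, u 3, u 4, u 5] := fun u => by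
    ext i; fin_cases i <;> rfl
  apply IsSymm6.of_generators <;> refine MvPolynomial.funext fun u => ?_ <;>
    rw [MvPolynomial.eval_rename, hu (u ∘ _), hu u, eval_m4, eval_m4, eval_d4, eval_d4,
      eval_z4, eval_z4] <;> simp [edgePerm, d3] <;> ring

section
open MvPolynomial

theorem isHomogeneous_ofNat_mul {f : Poly6} {d : ℕ} (hf : f.IsHomogeneous d) (n : ℕ) [n.AtLeastTwo] :
    (OfNat.ofNat n * f : Poly6).IsHomogeneous d := by
  rw [← map_ofNat (C : ℝ →+* Poly6) n]
  exact hf.C_mul _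

theorem isHomogeneous_d3 {p q r : Poly6} {d : ℕ} (hp : p.IsHomogeneous d) (hq : q.IsHomogeneous d)
    (hr : r.IsHomogeneous d) : (d3 p q r).IsHomogeneous (d + d + d) :=
  (((hp.neg.add hq).add hr).mul ((hp.sub hq).add hr)).mul ((hp.add hq).sub hr)

theorem isHomogeneous_av {f : Poly6} {d : ℕ} (hf : f.IsHomogeneous d) : (av f).IsHomogeneous d :=
  (IsHomogeneous.sum _ _ _ fun _ _ => hf.rename_isHomogeneous).C_mul _

theorem isHomogeneous_m4 : m4.IsHomogeneous 6 := by
  have hX : ∀ i, (X i : Poly6).IsHomogeneous 1 := isHomogeneous_X ℝ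
  have hp : p4.IsHomogeneous 6 :=
    (((((hX 0).mul (hX 1)).mul (hX 2)).mul (hX 3)).mul (hX 4)).mul (hX 5)
  have hn : n4.IsHomogeneous 6 := hp.sub (isHomogeneous_d3 ((hX _).mul (hX _)) ((hX _).mul (hX _))
    ((hX _).mul (hX _)))
  have hs : ∀ i j k, ((X i + X j - X k : Poly6)).IsHomogeneous 1 := fun i j k =>
    ((hX i).add (hX j)).sub (hX k)
  have hv : v4.IsHomogeneous 3 := (((hs _ _ _).sub (hX _)).mul ((hs _ _ _).sub (hX _))).mul
    ((hs _ _ _).sub (hX _))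
  have hX2 : ∀ i, (X i ^ 2 : Poly6).IsHomogeneous 2 := fun i => (hX i).pow 2
  have hX4 : ∀ i, (X i ^ 4 : Poly6).IsHomogeneous 4 := fun i => (hX i).pow 4
  have hz : z4.IsHomogeneous 6 := by
    have e1 : ∀ i j k l m n, (X i ^ 2 * X j ^ 2 * (X k ^ 2 + X l ^ 2 + X m ^ 2 + X n ^ 2) :
        Poly6).IsHomogeneous 6 := fun i j k l m n =>
      ((hX2 i).mul (hX2 j)).mul ((((hX2 k).add (hX2 l)).add (hX2 m)).add (hX2 n))
    have e2 : ∀ i j k, (X i ^ 2 * X j ^ 2 * X k ^ 2 : Poly6).IsHomogeneous 6 := fun i j k =>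
      ((hX2 i).mul (hX2 j)).mul (hX2 k)
    have e3 : ∀ i j, (X i ^ 4 * X j ^ 2 : Poly6).IsHomogeneous 6 := fun i j =>
      (hX4 i).mul (hX2 j)
    have e4 : ∀ i j, (X i ^ 2 * X j ^ 4 : Poly6).IsHomogeneous 6 := fun i j =>
      (hX2 i).mul (hX4 j)
    exact ((((e1 _ _ _ _ _ _).add (e1 _ _ _ _ _ _)).add (e1 _ _ _ _ _ _)).sub
      ((((((e3 _ _).add (e4 _ _)).add (e3 _ _)).add (e4 _ _)).add (e3 _ _)).add (e4 _ _))).sub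
      ((((e2 _ _ _).add (e2 _ _ _)).add (e2 _ _ _)).add (e2 _ _ _))
  have ha : (av (va * ((vb + vc) ^ 2 - vy ^ 2) * d3 vx vy vz)).IsHomogeneous 6 :=
    isHomogeneous_av (((hX 0).mul ((((hX 1).add (hX 2)).pow 2).sub (hX2 4))).mul
      (isHomogeneous_d3 (hX 3) (hX 4) (hX 5)))
  have hd : d4.IsHomogeneous 6 :=
    (((isHomogeneous_ofNat_mul hp 60).add (isHomogeneous_ofNat_mul hn 4)).add
      (isHomogeneous_ofNat_mul hz 2)).add (isHomogeneous_ofNat_mul ha 12)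
  exact hd.sub (((isHomogeneous_ofNat_mul hp 64).add (isHomogeneous_ofNat_mul hz 4)).add (hv.pow 2))

end

/-! ### The determinant for four points -/

theorem det_fin_four {R : Type*} [CommRing R] (M : Matrix (Fin 4) (Fin 4) R) :
    M.det =
      M 0 0 * (M 1 1 * (M 2 2 * M 3 3 - M 2 3 * M 3 2) - M 1 2 * (M 2 1 * M 3 3 - M 2 3 * M 3 1)
        + M 1 3 * (M 2 1 * M 3 2 - M 2 2 * M 3 1))
      - M 0 1 * (M 1 0 * (M 2 2 * M 3 3 - M 2 3 * M 3 2) - M 1 2 * (M 2 0 * M 3 3 - M 2 3 * M 3 0)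
        + M 1 3 * (M 2 0 * M 3 2 - M 2 2 * M 3 0))
      + M 0 2 * (M 1 0 * (M 2 1 * M 3 3 - M 2 3 * M 3 1) - M 1 1 * (M 2 0 * M 3 3 - M 2 3 * M 3 0)
        + M 1 3 * (M 2 0 * M 3 1 - M 2 1 * M 3 0))
      - M 0 3 * (M 1 0 * (M 2 1 * M 3 2 - M 2 2 * M 3 1) - M 1 1 * (M 2 0 * M 3 2 - M 2 2 * M 3 0)
        + M 1 2 * (M 2 0 * M 3 1 - M 2 1 * M 3 0)) := by
  rw [Matrix.det_succ_row_zero]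
  simp only [Fin.sum_univ_four, Matrix.det_fin_three, Matrix.submatrix_apply]
  have e : ∀ i : Fin 4, (Fin.succAbove i : Fin 3 → Fin 4) = 
    ![![1, 2, 3], ![0, 2, 3], ![0, 1, 3], ![0, 1, 2]] i := by decide
  simp only [e]
  simp
  ring

/-- The coefficient vector of the product of the linear polynomials `p.1 + p.2 T`, `q.1 + q.2 T` and
`r.1 + r.2 T`. -/
def cubicCoeff (p q r : ℂ × ℂ) : Fin 4 → ℂ :=
  ![p.1 * q.1 * r.1,
    p.2 * q.1 * r.1 + p.1 * q.2 * r.1 + p.1 * q.1 * r.2,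
    p.1 * q.2 * r.2 + p.2 * q.1 * r.2 + p.2 * q.2 * r.1,
    p.2 * q.2 * r.2]

/-- The matrix whose columns are the coefficient vectors of the cubics attached to four points, where
`x`, `z`, `a`, `y`, `b`, `c` are the lifts on the edges `AB`, `AC`, `AD`, `BC`, `BD`, `CD`. -/
def cubicMatrix (x z a y b c : ℂ × ℂ) : Matrix (Fin 4) (Fin 4) ℂ :=
  Matrix.of fun i j => ![cubicCoeff x z a, cubicCoeff (antipode x) y b,
    cubicCoeff (antipode z) (antipode y) c,
    cubicCoeff (antipode a) (antipode b) (antipode c)] j i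

open Polynomial in
theorem coeff_prod_three (p q r : ℂ × ℂ) (i : Fin 4) :
    ((C p.1 + C p.2 * X) * ((C q.1 + C q.2 * X) * (C r.1 + C r.2 * X))).coeff i
      = cubicCoeff p q r i := by
  have h : (C p.1 + C p.2 * X) * ((C q.1 + C q.2 * X) * (C r.1 + C r.2 * X)) =
      C (p.1 * q.1 * r.1) * X ^ 0
        + C (p.2 * q.1 * r.1 + p.1 * q.2 * r.1 + p.1 * q.1 * r.2) * X ^ 1
        + C (p.1 * q.2 * r.2 + p.2 * q.1 * r.2 + p.2 * q.2 * r.1) * X ^ 2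
        + C (p.2 * q.2 * r.2) * X ^ 3 := by
    simp only [C_add, C_mul]; ring
  rw [h]
  simp only [coeff_add, coeff_C_mul_X_pow]
  fin_cases i <;> simp [cubicCoeff]

/-- For four points the normalized lifts on the six edges `i < j` determine the matrix. -/
theorem liftMatrix_four {L : Fin 4 → Fin 4 → ℂ × ℂ}
    (hL : ∀ i j, i < j → L j i = antipode (L i j)) :
    liftMatrix L = cubicMatrix (L 0 1) (L 0 2) (L 0 3) (L 1 2) (L 1 3) (L 2 3) := by
  have e0 : Finset.univ.erase (0 : Fin 4) = {1, 2, 3} := by decide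
  have e1 : Finset.univ.erase (1 : Fin 4) = {0, 2, 3} := by decide
  have e2 : Finset.univ.erase (2 : Fin 4) = {0, 1, 3} := by decide
  have e3 : Finset.univ.erase (3 : Fin 4) = {0, 1, 2} := by decide
  have p3 : ∀ (f : Fin 4 → Polynomial ℂ) (i j k : Fin 4), i ≠ j → i ≠ k → j ≠ k →
      ∏ l ∈ {i, j, k}, f l = f i * (f j * f k) := by
    intro f i j k h1 h2 h3
    rw [Finset.prod_insert (by simp [h1, h2]), Finset.prod_pair h3]
  ext i j
  simp only [liftMatrix, cubicMatrix, Matrix.of_apply]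
  fin_cases j
  · simp only [Fin.mk_zero, e0]
    rw [p3 _ _ _ _ (by decide) (by decide) (by decide), coeff_prod_three]
    rfl
  · simp only [Fin.mk_one, e1]
    rw [p3 _ _ _ _ (by decide) (by decide) (by decide), coeff_prod_three, hL 0 1 (by decide)]
    rfl
  · simp only [Fin.reduceFinMk, e2]
    rw [p3 _ _ _ _ (by decide) (by decide) (by decide), coeff_prod_three, hL 0 2 (by decide),
      hL 1 2 (by decide)]
    rfl
  · simp only [Fin.reduceFinMk, e3]
    rw [p3 _ _ _ _ (by decide) (by decide) (by decide), coeff_prod_three, hL 0 3 (by decide),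
      hL 1 3 (by decide), hL 2 3 (by decide)]
    rfl

/-- The norm of `hopf q`, as an expression in `q`. -/
noncomputable def hopfNorm (q : ℂ × ℂ) : ℝ := (‖q.1‖ ^ 2 + ‖q.2‖ ^ 2) / 2

/-- The inner product of `hopf p` and `hopf q` in `ℝ × ℂ = ℝ³`. -/
noncomputable def hopfInner (p q : ℂ × ℂ) : ℝ :=
  (hopf p).1 * (hopf q).1 + ((hopf p).2 * starRingEnd ℂ (hopf q).2).re

/-- The real part of the determinant in terms of the norms `r` and the inner products `d` of the edge
vectors. The pair of conjugate linear factors on an edge enters the determinant only through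
`z z̄`, `w w̄`, `z w̄`, `w z̄`, so the real part is a rotation invariant polynomial, linear in the
pair (length, vector) of each edge. The first eight terms are the perfect matchings of the six edges
into adjacent pairs; with the edges directed as `AB`, `AC`, `AD`, `BC`, `BD`, `CD`, an inner product
of adjacent edges has sign `+` if both are directed away from, or both towards, the common vertex and
`-` otherwise. The remaining terms pair opposite edges. -/
theorem re_det_cubicMatrix (x z a y b c : ℂ × ℂ) (r : ℂ × ℂ → ℝ) (d : ℂ × ℂ → ℂ × ℂ → ℝ)
    (hr : r = hopfNorm) (hd : d = hopfInner) :
    (cubicMatrix x z a y b c).det.re =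
      4 * ((r x * r z + d x z) * (r a * r b + d a b) * (r y * r c - d y c)
        + (r x * r z + d x z) * (r a * r c + d a c) * (r y * r b + d y b)
        + (r x * r a + d x a) * (r z * r y + d z y) * (r b * r c + d b c)
        + (r x * r a + d x a) * (r z * r c - d z c) * (r y * r b + d y b)
        + (r x * r y - d x y) * (r z * r a + d z a) * (r b * r c + d b c)
        + (r x * r y - d x y) * (r z * r c - d z c) * (r a * r b + d a b)
        + (r x * r b - d x b) * (r z * r a + d z a) * (r y * r c - d y c)
        + (r x * r b - d x b) * (r z * r y + d z y) * (r a * r c + d a c))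
      + 8 * (r x * r c * d z b * d a y - r z * r b * d x c * d a y + r a * r y * d x c * d z b
        - r x * r z * r a * r y * r b * r c) := by
  have hrC : ∀ q : ℂ × ℂ, (r q : ℂ) =
      (q.1 * starRingEnd ℂ q.1 + q.2 * starRingEnd ℂ q.2) / 2 := by
    intro q
    simp only [hr, hopfNorm, Complex.mul_conj']
    push_cast
    rfl
  have hdC : ∀ p q : ℂ × ℂ, (d p q : ℂ) =
      (p.1 * starRingEnd ℂ p.1 - p.2 * starRingEnd ℂ p.2)
        * (q.1 * starRingEnd ℂ q.1 - q.2 * starRingEnd ℂ q.2) / 4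
      + (p.1 * starRingEnd ℂ p.2 * (q.2 * starRingEnd ℂ q.1)
        + p.2 * starRingEnd ℂ p.1 * (q.1 * starRingEnd ℂ q.2)) / 2 := by
    intro p q
    simp only [hd, hopfInner, hopf]
    push_cast
    rw [Complex.re_eq_add_conj]
    simp only [← Complex.mul_conj', map_mul, Complex.conj_conj]
    ring
  -- twice the real part is the determinant plus its conjugate, a polynomial identity in the entries
  -- of the lifts and their conjugates
  have key := Complex.add_conj (cubicMatrix x z a y b c).det
  rw [RingHom.map_det] at key
  have hinj : Function.Injective (fun t : ℝ => ((2 * t : ℝ) : ℂ)) := fun s t h => by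
    simpa using h
  apply hinj
  simp only
  rw [← key, det_fin_four, det_fin_four]
  simp only [cubicMatrix, Matrix.of_apply, RingHom.mapMatrix_apply, Matrix.map_apply]
  simp only [cubicCoeff, antipode, Matrix.cons_val, map_add, map_mul, map_neg, Complex.conj_conj]
  push_cast
  simp only [hrC, hdC]
  ring

/-! ### Lengths and inner products of edge vectors -/

theorem hopfNorm_eq {q : ℂ × ℂ} {v : E3} (h : hopf q = toRC v) : hopfNorm q = ‖v‖ := by
  have h1 : (‖q.1‖ ^ 2 - ‖q.2‖ ^ 2) / 2 = v 0 := congrArg Prod.fst h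
  have h2 : q.1 * starRingEnd ℂ q.2 = ⟨v 1, v 2⟩ := congrArg Prod.snd h
  have h3 : (‖q.1‖ * ‖q.2‖) ^ 2 = v 1 ^ 2 + v 2 ^ 2 := by
    have := congrArg Complex.normSq h2
    rw [Complex.normSq_eq_norm_sq, norm_mul, RCLike.norm_conj, Complex.normSq_mk] at this
    linarith
  refine (pow_left_inj₀ (by unfold hopfNorm; positivity) (norm_nonneg v) two_ne_zero).mp ?_
  rw [norm_sq_E3, ← h1, hopfNorm]
  linarith

/-- The inner product of two edge vectors in terms of squared distances. -/
theorem hopfInner_eq {p q : ℂ × ℂ} {P Q R S : E3} (hp : hopf p = toRC (Q - P))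
    (hq : hopf q = toRC (S - R)) :
    hopfInner p q = (dist P S ^ 2 + dist Q R ^ 2 - dist P R ^ 2 - dist Q S ^ 2) / 2 := by
  simp only [hopfInner, hp, hq, toRC, dist_sq_E3, PiLp.sub_apply]
  simp
  ring

/-- `Re At = d₄`; for coincident points this says that `d₄` vanishes on the distance vector. -/
theorem re_atiyahDet (A B C D : E3) :
    (atiyahDet ![A, B, C, D]).re = MvPolynomial.eval (distVec A B C D) d4 := by
  unfold distVec
  rw [eval_d4, eval_z4]
  by_cases hinj : Function.Injective ![A, B, C, D]
  · have hL := isNormalizedLift_normalizedLift ![A, B, C, D]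
    rw [atiyahDet_eq hinj hL, liftMatrix_four hL.antipode_eq,
      re_det_cubicMatrix _ _ _ _ _ _ hopfNorm hopfInner rfl rfl]
    have hx := hL.hopf_eq 0 1 (by decide)
    have hz := hL.hopf_eq 0 2 (by decide)
    have ha := hL.hopf_eq 0 3 (by decide)
    have hy := hL.hopf_eq 1 2 (by decide)
    have hb := hL.hopf_eq 1 3 (by decide)
    have hc := hL.hopf_eq 2 3 (by decide)
    generalize normalizedLift ![A, B, C, D] 0 1 = x at *
    generalize normalizedLift ![A, B, C, D] 0 2 = z at *
    generalize normalizedLift ![A, B, C, D] 0 3 = a at *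
    generalize normalizedLift ![A, B, C, D] 1 2 = y at *
    generalize normalizedLift ![A, B, C, D] 1 3 = b at *
    generalize normalizedLift ![A, B, C, D] 2 3 = c at *
    change hopf x = toRC (B - A) at hx
    change hopf z = toRC (C - A) at hz
    change hopf a = toRC (D - A) at ha
    change hopf y = toRC (C - B) at hy
    change hopf b = toRC (D - B) at hb
    change hopf c = toRC (D - C) at hc
    rw [hopfInner_eq hx hz, hopfInner_eq hx ha, hopfInner_eq hx hy, hopfInner_eq hx hb,
      hopfInner_eq hx hc, hopfInner_eq hz ha, hopfInner_eq hz hy, hopfInner_eq hz hb,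
      hopfInner_eq hz hc, hopfInner_eq ha hy, hopfInner_eq ha hb, hopfInner_eq ha hc,
      hopfInner_eq hy hb, hopfInner_eq hy hc, hopfInner_eq hb hc,
      hopfNorm_eq hx, hopfNorm_eq hz, hopfNorm_eq ha, hopfNorm_eq hy, hopfNorm_eq hb,
      hopfNorm_eq hc, ← dist_eq_norm, ← dist_eq_norm, ← dist_eq_norm, ← dist_eq_norm,
      ← dist_eq_norm, ← dist_eq_norm]
    simp only [dist_self, dist_comm D A, dist_comm D B, dist_comm D C, dist_comm B A,
      dist_comm C B, dist_comm C A, d3]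
    ring
  · -- if two points coincide, one distance is zero and four others agree in pairs
    have h0 : atiyahDet ![A, B, C, D] = 0 := by rw [atiyahDet, if_neg hinj]
    have hcases : A = B ∨ A = C ∨ A = D ∨ B = C ∨ B = D ∨ C = D := by
      by_contra! h
      obtain ⟨h1, h2, h3, h4, h5, h6⟩ := h
      apply hinj
      intro i j hij
      fin_cases i <;> fin_cases j <;> simp_all
    rw [h0, Complex.zero_re]
    rcases hcases with rfl | rfl | rfl | rfl | rfl | rfl
    · rw [dist_self]; simp only [d3]; ring
    · rw [dist_self, dist_comm B A]; simp only [d3]; ring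
    · rw [dist_self, dist_comm B A, dist_comm C A]; simp only [d3]; ring
    · rw [dist_self]; simp only [d3]; ring
    · rw [dist_self, dist_comm C B]; simp only [d3]; ring
    · rw [dist_self]; simp only [d3]; ring

/-! ### Conjecture II for four points -/

theorem mainTheorem1 :
    -- `m₄` is a symmetric homogeneous polynomial of degree 6, nonnegative on geometric vectors
    (m4.IsHomogeneous 6 ∧ IsSymm6 m4) ∧
    (∀ u : Fin 6 → ℝ, IsGeometric u → 0 ≤ MvPolynomial.eval u m4) ∧
    -- `d₄ ≥ 64 p₄` on geometric vectors
    (∀ u : Fin 6 → ℝ, IsGeometric u →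
      64 * (u 0 * u 1 * u 2 * u 3 * u 4 * u 5) ≤ MvPolynomial.eval u d4) ∧
    -- `|At| ≥ Re At = d₄`
    (∀ A B C D : E3,
      (atiyahDet ![A, B, C, D]).re = MvPolynomial.eval (distVec A B C D) d4 ∧
      (atiyahDet ![A, B, C, D]).re ≤ ‖atiyahDet ![A, B, C, D]‖) ∧
    -- Conjecture II for four points
    (∀ A B C D : E3,
      64 * (dist A D * dist B D * dist C D * dist A B * dist B C * dist A C) ≤
        ‖atiyahDet ![A, B, C, D]‖) := by
  refine ⟨⟨isHomogeneous_m4, isSymm6_m4⟩, ?_, ?_, fun A B C D =>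
    ⟨re_atiyahDet A B C D, Complex.re_le_norm _⟩, fun A B C D => ?_⟩
  · rintro _ ⟨A, B, C, D, rfl⟩
    exact eval_m4_nonneg A B C D
  · rintro _ ⟨A, B, C, D, rfl⟩
    exact le_eval_d4 A B C D
  · calc _ ≤ MvPolynomial.eval (distVec A B C D) d4 := le_eval_d4 A B C D
      _ = (atiyahDet ![A, B, C, D]).re := (re_atiyahDet A B C D).symm
      _ ≤ _ := Complex.re_le_norm _
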